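/- Let $n\ge 1$ and $l\ge 1$ be integers and let $A=\{a_1\prec a_2\prec\dots\prec a_l\}$ be a linearly ordered alphabet of cardinality $l$. For words $u,v$ over $A$ write $u\succ v$ if $u=w\,a\,s$ and $v=w\,b\,t$ for some words $w,s,t$ and letters $a\succ b$ (lexicographic order; two words one of which is a prefix of the other are incomparable). A word $W$ is called $n$-divisible if $W=vu_1u_2\cdots u_n$ for some words $v,u_1,\dots,u_n$ with $u_1\succ u_2\succ\dots\succ u_n$. The height of a set $S$ of words over a set $Y$ of words is the least integer $h$ such that every $W\in S$ can be written as $W=u_1^{k_1}u_2^{k_2}\cdots u_r^{k_r}$ with $r\le h$, $u_i\in Y$ and $k_i\ge 0$. Theorem. The height of the set of all words over $A$ that are not $n$-divisible, over the set of words over $A$ of length less than $n$, is finite and does not exceed $$\Phi(n,l)=2^{40}\, l\, n^{38+8\log_2 n}.$$ -/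

import Mathlib

/-- Words over an alphabet `α` are lists of letters. `Word.Gt u v` is the (partial) strict
lexicographic order `u ≻ v`: at the first position where the two words differ, the letter of `u`
is the greater one. A word and a proper (or improper) prefix of it are incomparable. -/
def Word.Gt {α : Type*} [LinearOrder α] (u v : List α) : Prop :=
  ∃ (w s t : List α) (a b : α), u = w ++ a :: s ∧ v = w ++ b :: t ∧ b < a

/-- `W` is `n`-divisible: `W = v u₁ u₂ ⋯ uₙ` with `u₁ ≻ u₂ ≻ ⋯ ≻ uₙ`. -/
def Word.IsDivisible {α : Type*} [LinearOrder α] (n : ℕ) (W : List α) : Prop :=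
  ∃ (v : List α) (us : List (List α)),
    us.length = n ∧ us.IsChain Word.Gt ∧ W = v ++ us.flatten

/-- The power `u ^ k` of a word: the concatenation of `k` copies of `u`. -/
def Word.power {α : Type*} (u : List α) (k : ℕ) : List α :=
  (List.replicate k u).flatten

/-- `W` is a product `u₁ ^ k₁ ⋯ u_r ^ k_r` of powers of words `uᵢ ∈ Y` with `r ≤ h`. -/
def Word.IsProductOfPowers {α : Type*} (Y : Set (List α)) (h : ℕ) (W : List α) : Prop :=
  ∃ fs : List (List α × ℕ), fs.length ≤ h ∧ (∀ f ∈ fs, f.1 ∈ Y) ∧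
    W = (fs.map fun f => Word.power f.1 f.2).flatten

/-- The height of a set `S` of words over a set `Y` of words: the least `h` such that every word
of `S` is a product of at most `h` powers of words of `Y` (and `⊤` if there is no such `h`). -/
noncomputable def Word.height {α : Type*} (Y S : Set (List α)) : ℕ∞ :=
  ⨅ (h : ℕ) (_ : ∀ W ∈ S, Word.IsProductOfPowers Y h W), (h : ℕ∞)

/-! Let `W` be not `n`-divisible and fix a window length `2 ^ s` between `4 * n` and `8 * n`. A long
descent among the windows would contain `n` disjoint windows in decreasing order, hence an
`n`-division. So `descentRank` colours the positions with `p = n * 2 ^ s` colours, and windows of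
one colour weakly increase (`descentRank_factor_lt`). Monotonicity makes each doubling of the factor
length multiply the number of coloured factors by at most `2 * p ^ 2`
(`card_colored_factors_double`). Hence `s` doublings, about `log₂ n`, leave few distinct windows:
this is the source of the logarithm in the exponent. A window that is not periodic with period below
`n` in its middle part occurs at most `n * 2 ^ s` times: its first `n` suffixes are pairwise
incomparable as prefixes, and picking them in decreasing order from disjoint occurrences would give
an `n`-division (`card_occurrences_le`). So few positions are not locally periodic. Between them,
`W` is a power of a short word followed by a short remainder (`isProductOfPowers_drop`). -/

namespace Word

/-! ### Lexicographic comparison and divisibility from disjoint factors. -/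

section Order

variable {α : Type*} [LinearOrder α]

theorem Gt.of_prefix {u v u' v' : List α} (h : Gt u v) (hu : u <+: u') (hv : v <+: v') :
    Gt u' v' := by
  obtain ⟨w, s, t, a, b, rfl, rfl, hab⟩ := h
  obtain ⟨x, rfl⟩ := hu
  obtain ⟨y, rfl⟩ := hv
  exact ⟨w, s ++ x, t ++ y, a, b, by simp, by simp, hab⟩

theorem Gt.cons {u v : List α} (h : Gt u v) (a : α) : Gt (a :: u) (a :: v) := by
  obtain ⟨w, s, t, b, c, rfl, rfl, hbc⟩ := h
  exact ⟨a :: w, s, t, b, c, rfl, rfl, hbc⟩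

/-- A lexicographically greater list is greater as a word, unless it extends the smaller one. -/
theorem gt_or_prefix_of_lt {u v : List α} (h : v < u) : Gt u v ∨ v <+: u := by
  induction u generalizing v with
  | nil => simp at h
  | cons a u ih =>
    cases v with
    | nil => exact Or.inr (List.nil_prefix)
    | cons b v =>
      rcases List.cons_lt_cons_iff.1 h with hab | ⟨rfl, hlt⟩
      · exact Or.inl ⟨[], u, v, a, b, rfl, rfl, hab⟩
      · rcases ih hlt with hg | hp
        · exact Or.inl (hg.cons b)
        · exact Or.inr (by simpa using hp)

theorem gt_of_lt_of_length_eq {u v : List α} (h : v < u) (hl : v.length = u.length) : Gt u v :=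
  (gt_or_prefix_of_lt h).resolve_right fun hp => h.ne (hp.eq_of_length hl)

theorem lt_of_take_lt_take {u v : List α} {k : ℕ} (h : u.take k < v.take k) : u < v := by
  induction k generalizing u v with
  | zero => simp at h
  | succ k ih =>
    cases v with
    | nil => simp at h
    | cons b v =>
      cases u with
      | nil => exact List.nil_lt_cons b v
      | cons a u =>
        rw [List.take_succ_cons, List.take_succ_cons, List.cons_lt_cons_iff] at h
        exact List.cons_lt_cons_iff.2 (h.imp id fun h => ⟨h.1, ih h.2⟩)

theorem take_le_take {u v : List α} (h : u ≤ v) (k : ℕ) : u.take k ≤ v.take k :=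
  not_lt.1 fun hc => not_lt.2 h (lt_of_take_lt_take hc)

/-- Each `y k` is extended up to the start of the next one, and `Gt` survives extension of both
sides. The final prefix clause is what lets the induction compare a new block with its successor. -/
theorem exists_chain_flatten_eq_drop (W : List α) (n : ℕ) (s : ℕ → ℕ) (y : ℕ → List α)
    (hy : ∀ k ≤ n, y k <+: W.drop (s k)) (hs : ∀ k < n, s k + (y k).length ≤ s (k + 1))
    (hgt : ∀ k < n, Gt (y k) (y (k + 1))) :
    ∃ (u : List α) (us : List (List α)), us.length = n ∧ (u :: us).IsChain Gt ∧
      W.drop (s 0) = (u :: us).flatten ∧ y 0 <+: u := by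
  induction n generalizing s y with
  | zero => exact ⟨W.drop (s 0), [], by simp, by simp, by simp, hy 0 le_rfl⟩
  | succ n ih =>
    obtain ⟨u, us, hlen, hch, hW, hu⟩ := ih (fun k => s (k + 1)) (fun k => y (k + 1))
      (fun k hk => hy _ (by omega)) (fun k hk => hs _ (by omega)) (fun k hk => hgt _ (by omega))
    have h0 := hs 0 (by omega)
    simp only [zero_add] at h0 hW hu
    have hp : y 0 <+: (W.drop (s 0)).take (s 1 - s 0) :=
      List.prefix_take_iff.2 ⟨hy 0 (by omega), by omega⟩
    refine ⟨(W.drop (s 0)).take (s 1 - s 0), u :: us, by simp [hlen], ?_, ?_, hp⟩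
    · exact List.isChain_cons_cons.2 ⟨(hgt 0 (by omega)).of_prefix hp hu, hch⟩
    · rw [List.flatten_cons, ← hW]
      conv_lhs => rw [← List.take_append_drop (s 1 - s 0) (W.drop (s 0)), List.drop_drop]
      congr 2
      omega

/-- Non-overlapping occurrences of a decreasing sequence of words witness divisibility. -/
theorem isDivisible_of_prefixes {W : List α} {n : ℕ} (hn : 1 ≤ n) (s : ℕ → ℕ) (y : ℕ → List α)
    (hy : ∀ k < n, y k <+: W.drop (s k)) (hs : ∀ k, k + 1 < n → s k + (y k).length ≤ s (k + 1))
    (hgt : ∀ k, k + 1 < n → Gt (y k) (y (k + 1))) : IsDivisible n W := by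
  obtain ⟨m, rfl⟩ : ∃ m, n = m + 1 := ⟨n - 1, by omega⟩
  obtain ⟨u, us, hlen, hch, hW, -⟩ := exists_chain_flatten_eq_drop W m s y
    (fun k hk => hy k (by omega)) (fun k hk => hs k (by omega)) (fun k hk => hgt k (by omega))
  exact ⟨W.take (s 0), u :: us, by simp [hlen], hch, by rw [← hW, List.take_append_drop]⟩

end Order

/-! ### Colouring positions by the length of descents. -/

section Rank

variable {β : Type*} [LinearOrder β]

/-- The length of the longest strictly decreasing subsequence of `f` ending at `i`, minus one. -/
def descentRank (f : ℕ → β) (i : ℕ) : ℕ :=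
  (Finset.range i).attach.sup fun j => if f i < f j then descentRank f j + 1 else 0
termination_by i
decreasing_by exact Finset.mem_range.1 j.2

theorem descentRank_lt {f : ℕ → β} {i j : ℕ} (hij : i < j) (h : f j < f i) :
    descentRank f i < descentRank f j := by
  rw [descentRank.eq_1 f j]
  refine Nat.lt_of_succ_le ?_
  have := Finset.le_sup (f := fun k : {x // x ∈ Finset.range j} =>
    if f j < f k then descentRank f k + 1 else 0)
    (Finset.mem_attach _ ⟨i, Finset.mem_range.2 hij⟩)
  simpa [h] using this

theorem le_of_descentRank_eq {f : ℕ → β} {i j : ℕ} (hij : i ≤ j)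
    (h : descentRank f i = descentRank f j) : f i ≤ f j := by
  rcases hij.eq_or_lt with rfl | hlt
  · exact le_rfl
  · by_contra hc
    exact (descentRank_lt hlt (not_le.1 hc)).ne h

theorem exists_descentRank_eq {f : ℕ → β} {i m : ℕ} (h : descentRank f i = m + 1) :
    ∃ j < i, f i < f j ∧ descentRank f j = m := by
  rw [descentRank.eq_1] at h
  have hne : (Finset.range i).attach.Nonempty := by
    by_contra hc
    rw [Finset.not_nonempty_iff_eq_empty.1 hc] at h
    simp at h
  obtain ⟨j, -, hj⟩ := Finset.exists_mem_eq_sup _ hne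
    (fun j : {x // x ∈ Finset.range i} => if f i < f j then descentRank f j + 1 else 0)
  rw [h] at hj
  split_ifs at hj with hlt
  exact ⟨j, Finset.mem_range.1 j.2, hlt, by omega⟩

theorem exists_descending {f : ℕ → β} {i m : ℕ} (h : descentRank f i = m) :
    ∃ t : ℕ → ℕ, t m = i ∧ ∀ k < m, t k < t (k + 1) ∧ f (t (k + 1)) < f (t k) := by
  induction m generalizing i with
  | zero => exact ⟨fun _ => i, rfl, by simp⟩
  | succ m ih =>
    obtain ⟨j, hji, hlt, hj⟩ := exists_descentRank_eq h
    obtain ⟨t, ht, hstep⟩ := ih hj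
    refine ⟨Function.update t (m + 1) i, by simp, fun k hk => ?_⟩
    rcases Nat.lt_succ_iff_lt_or_eq.1 hk with hk' | rfl
    · rw [Function.update_of_ne (by omega), Function.update_of_ne (by omega)]
      exact hstep k hk'
    · rw [Function.update_of_ne (by omega), Function.update_self, ht]
      exact ⟨hji, hlt⟩

theorem exists_descending_of_le {f : ℕ → β} {i m : ℕ} (h : m ≤ descentRank f i) :
    ∃ t : ℕ → ℕ, ∀ k < m, t k < t (k + 1) ∧ f (t (k + 1)) < f (t k) := by
  obtain ⟨t, -, ht⟩ := exists_descending (rfl : descentRank f i = _)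
  exact ⟨t, fun k hk => ht k (hk.trans_le h)⟩

theorem add_le_of_step {t : ℕ → ℕ} {m a d : ℕ} (h : ∀ k < m, t k < t (k + 1)) (hd : a + d ≤ m) :
    t a + d ≤ t (a + d) := by
  induction d with
  | zero => simp
  | succ d ih =>
    have h1 := ih (by omega)
    have h2 := h (a + d) (by omega)
    rw [← add_assoc a d 1]
    omega

theorem lt_of_step {f : ℕ → β} {t : ℕ → ℕ} {m a d : ℕ}
    (h : ∀ k < m, f (t (k + 1)) < f (t k)) (hd : a + (d + 1) ≤ m) :
    f (t (a + (d + 1))) < f (t a) := by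
  induction d with
  | zero => exact h a (by omega)
  | succ d ih => exact (h (a + (d + 1)) (by omega)).trans (ih (by omega))

end Rank

/-- The factor of `W` of length `k` starting at position `i`, truncated at the end of `W`. -/
def factor {α : Type*} (W : List α) (i k : ℕ) : List α :=
  (W.drop i).take k

theorem factor_add {α : Type*} (W : List α) (i k m : ℕ) :
    factor W i (k + m) = factor W i k ++ factor W (i + k) m := by
  simp only [factor, List.take_add, List.drop_drop]

theorem getElem?_factor {α : Type*} (W : List α) {i k x : ℕ} (hx : x < k) :
    (factor W i k)[x]? = W[i + x]? := by
  simp [factor, hx]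

/-! ### Few distinct windows. -/

section Counting

variable {α : Type*} [LinearOrder α]

/-- The windows of length `M` of a word that is not `n`-divisible have no long descents. -/
theorem descentRank_factor_lt {W : List α} {n M : ℕ} (hn : 1 ≤ n) (hM : 1 ≤ M)
    (hW : ¬ IsDivisible n W) (i : ℕ) : descentRank (fun j => factor W j M) i < n * M := by
  by_contra hc
  obtain ⟨t, ht⟩ := exists_descending_of_le (not_lt.1 hc)
  have hstep : ∀ k < n * M, t k < t (k + 1) := fun k hk => (ht k hk).1
  have hidx : ∀ k < n, k * M + M ≤ n * M := fun k hk => by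
    calc k * M + M = (k + 1) * M := by ring
      _ ≤ n * M := Nat.mul_le_mul_right _ hk
  -- Only windows near the end of `W` are truncated. This one is full because the window `M - 1`
  -- descents later exceeds another list, so it is nonempty and starts inside `W`.
  have hlen : ∀ k < n, (factor W (t (k * M)) M).length = M := fun k hk => by
    have h1 := add_le_of_step (a := k * M) (d := M - 1) hstep (by have := hidx k hk; omega)
    have h2 := (ht (k * M + (M - 1)) (by have := hidx k hk; omega)).2
    have h3 : t (k * M + (M - 1)) < W.length := by
      by_contra h
      have : factor W (t (k * M + (M - 1))) M = [] := by
        simp [factor, List.drop_eq_nil_of_le (not_lt.1 h)]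
      simp [this] at h2
    simp only [factor, List.length_take, List.length_drop]
    omega
  refine hW (isDivisible_of_prefixes hn (fun k => t (k * M)) (fun k => factor W (t (k * M)) M)
    (fun k _ => List.take_prefix _ _) (fun k hk => ?_) (fun k hk => ?_))
  · rw [hlen k (by omega), Nat.succ_mul]
    exact add_le_of_step hstep (hidx k (by omega))
  · refine gt_of_lt_of_length_eq ?_ (by rw [hlen k (by omega), hlen (k + 1) hk])
    obtain ⟨d, rfl⟩ : ∃ d, M = d + 1 := ⟨M - 1, by omega⟩
    have := lt_of_step (f := fun j => factor W j (d + 1)) (t := t) (a := k * (d + 1)) (d := d)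
      (fun k hk => (ht k hk).2) (hidx k (by omega))
    rw [Nat.succ_mul]
    exact this

/-- If a colouring `c` makes the factors of length `k` of each colour weakly increasing, the
number of coloured factors at most doubles, up to the number of pairs of colours, when the length
doubles. -/
theorem card_colored_factors_double {W : List α} {c : ℕ → ℕ} {p k E : ℕ} (hc : ∀ i, c i < p)
    (hmono : ∀ i j, i ≤ j → c i = c j → factor W i k ≤ factor W j k)
    (hE : ∀ N, ((Finset.range N).image fun i => (c i, factor W i k)).card ≤ E) (N : ℕ) :
    ((Finset.range N).image fun i => (c i, factor W i (k + k))).card ≤ 2 * E * p ^ 2 := by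
  classical
  -- `σ i` counts the coloured factors met up to `i`. If it does not grow from `i` to `j`, the pair
  -- at `j` already occurred at some `x ≤ i`, and monotonicity in the colour squeezes the factor at
  -- `i` between equal ones.
  set σ : ℕ → ℕ := fun i => ((Finset.range (i + 1)).image fun j => (c j, factor W j k)).card
    with hσ
  have hσmono : ∀ i j, i ≤ j → σ i ≤ σ j := fun i j hij =>
    Finset.card_le_card (Finset.image_subset_image (Finset.range_subset_range.2 (by omega)))
  have hσeq : ∀ i j, i ≤ j → c i = c j → σ i = σ j → factor W i k = factor W j k := by
    intro i j hij hcij hs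
    have himg := Finset.eq_of_subset_of_card_le (Finset.image_subset_image
      (f := fun j => (c j, factor W j k)) (Finset.range_subset_range.2 (by omega : i + 1 ≤ j + 1)))
      hs.ge
    have hmem : (c j, factor W j k) ∈
        (Finset.range (i + 1)).image fun j => (c j, factor W j k) := by
      rw [himg]
      exact Finset.mem_image_of_mem _ (Finset.self_mem_range_succ j)
    obtain ⟨x, hx, hxj⟩ := Finset.mem_image.1 hmem
    obtain ⟨hx1, hx2⟩ := Prod.mk.inj hxj
    refine le_antisymm (hmono i j hij hcij) ?_
    rw [← hx2]
    exact hmono x i (by simpa [Nat.lt_succ_iff] using hx) (hx1.trans hcij.symm)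
  -- Since `σ` is monotone, equality of the sums forces equality of both summands; one number up to
  -- `2 * E` thus replaces a pair of halves.
  set τ : ℕ → ℕ × ℕ × ℕ := fun i => (σ i + σ (i + k), c i, c (i + k)) with hτ
  have key : ∀ i j, i ≤ j → τ i = τ j →
      (c i, factor W i (k + k)) = (c j, factor W j (k + k)) := by
    intro i j hij h
    simp only [hτ, Prod.mk.injEq] at h
    obtain ⟨h1, h2, h3⟩ := h
    have m1 := hσmono i j hij
    have m2 := hσmono (i + k) (j + k) (by omega)
    rw [factor_add, factor_add, h2, hσeq i j hij h2 (by omega),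
      hσeq (i + k) (j + k) (by omega) h3 (by omega)]
  have hcard : ((Finset.range N).image fun i => (c i, factor W i (k + k))).card ≤
      ((Finset.range N).image τ).card := by
    choose! g hg using fun (x : ℕ × ℕ × ℕ) (hx : x ∈ (Finset.range N).image τ) =>
      Finset.mem_image.1 hx
    refine (Finset.card_le_card fun y hy => ?_).trans
      (Finset.card_image_le (s := (Finset.range N).image τ)
        (f := fun x => (c (g x), factor W (g x) (k + k))))
    obtain ⟨i, hi, rfl⟩ := Finset.mem_image.1 hy
    have hti := Finset.mem_image_of_mem τ hi
    refine Finset.mem_image.2 ⟨τ i, hti, ?_⟩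
    rcases le_total (g (τ i)) i with h | h
    · exact key _ _ h (hg _ hti).2
    · exact (key _ _ h (hg _ hti).2.symm).symm
  have hsub : (Finset.range N).image τ ⊆
      Finset.Ioc 0 (2 * E) ×ˢ Finset.range p ×ˢ Finset.range p := by
    intro x hx
    obtain ⟨i, -, rfl⟩ := Finset.mem_image.1 hx
    have h0 : 0 < σ i := Finset.card_pos.2
      ⟨_, Finset.mem_image_of_mem _ (Finset.self_mem_range_succ i)⟩
    have h1 : σ i ≤ E := hE (i + 1)
    have h2 : σ (i + k) ≤ E := hE (i + k + 1)
    simp only [hτ, Finset.mem_product, Finset.mem_Ioc, Finset.mem_range]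
    exact ⟨by omega, hc _, hc _⟩
  refine hcard.trans ((Finset.card_le_card hsub).trans ?_)
  simp only [Finset.card_product, Nat.card_Ioc, Finset.card_range, Nat.sub_zero]
  exact le_of_eq (by ring)

/-- The extra `1` accounts for the empty factor past the end of `W`. -/
theorem card_colored_letters [Fintype α] (W : List α) {c : ℕ → ℕ} {p : ℕ} (hc : ∀ i, c i < p)
    (N : ℕ) : ((Finset.range N).image fun i => (c i, factor W i 1)).card ≤
      p * (Fintype.card α + 1) := by
  classical
  have hsub : ((Finset.range N).image fun i => (c i, factor W i 1)) ⊆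
      Finset.range p ×ˢ (Finset.univ : Finset (Option α)).image Option.toList := by
    intro x hx
    obtain ⟨i, -, rfl⟩ := Finset.mem_image.1 hx
    refine Finset.mem_product.2 ⟨Finset.mem_range.2 (hc i), Finset.mem_image.2
      ⟨(W.drop i).head?, Finset.mem_univ _, ?_⟩⟩
    cases h : W.drop i <;> simp [factor, h]
  refine (Finset.card_le_card hsub).trans ?_
  rw [Finset.card_product, Finset.card_range]
  refine Nat.mul_le_mul_left _ (Finset.card_image_le.trans ?_)
  simp [Fintype.card_option]

theorem card_factors_le [Fintype α] {W : List α} {n s : ℕ} (hn : 1 ≤ n) (hW : ¬ IsDivisible n W)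
    (N : ℕ) : ((Finset.range N).image fun i => factor W i (2 ^ s)).card ≤
      (2 * (n * 2 ^ s) ^ 2) ^ s * (n * 2 ^ s * (Fintype.card α + 1)) := by
  classical
  set p := n * 2 ^ s with hp
  set c := descentRank fun j => factor W j (2 ^ s) with hcdef
  have hc : ∀ i, c i < p := descentRank_factor_lt hn Nat.one_le_two_pow hW
  have key : ∀ j ≤ s, ∀ N, ((Finset.range N).image fun i => (c i, factor W i (2 ^ j))).card ≤
      (2 * p ^ 2) ^ j * (p * (Fintype.card α + 1)) := by
    intro j
    induction j with
    | zero => intro _ N; simpa using card_colored_letters W hc N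
    | succ j ih =>
      intro hj N
      rw [pow_succ 2 j, mul_two]
      refine (card_colored_factors_double hc (fun a b hab hcab => ?_) (ih (by omega)) N).trans
        (le_of_eq (by ring))
      -- Truncation preserves weak order, so the colouring by the longest windows serves every
      -- scale.
      have h := take_le_take (le_of_descentRank_eq hab hcab) (2 ^ j)
      simpa only [factor, List.take_take,
        min_eq_left (Nat.pow_le_pow_right two_pos (by omega : j ≤ s))] using h
  refine le_trans ?_ (key s le_rfl N)
  have : ((Finset.range N).image fun i => factor W i (2 ^ s)) =
      ((Finset.range N).image fun i => (c i, factor W i (2 ^ s))).image Prod.snd := by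
    rw [Finset.image_image]; rfl
  rw [this]
  exact Finset.card_image_le

end Counting

/-! ### Aperiodic windows recur rarely; overlapping local periods merge. -/

section Periodicity

/-- The window of length `2 * n` of `W` at position `i` has a period less than `n`. -/
def IsLocallyPeriodic {α : Type*} (n : ℕ) (W : List α) (i : ℕ) : Prop :=
  ∃ q, 0 < q ∧ q < n ∧ ∀ x, i ≤ x → x + q < i + 2 * n → x + q < W.length → W[x]? = W[x + q]?

/-- Such a prefix relation is a period `b - a`. The shift by `n` clears every offset `a < n`, and `3
* n ≤ M` leaves room for the window of length `2 * n`. -/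
theorem not_drop_prefix_drop {α : Type*} {W : List α} {n M i a b : ℕ} (hM : 3 * n ≤ M)
    (hi : ¬ IsLocallyPeriodic n W (i + n)) (hab : a < b) (hb : b < n) :
    ¬ (factor W i M).drop b <+: (factor W i M).drop a := by
  rintro ⟨r, hr⟩
  refine hi ⟨b - a, by omega, by omega, fun x hx hxq hxW => ?_⟩
  have h1 : ((factor W i M).drop b)[x - i - a]? = W[x + (b - a)]? := by
    rw [List.getElem?_drop, getElem?_factor W (by omega)]
    congr 1
    omega
  have h2 : ((factor W i M).drop a)[x - i - a]? = W[x]? := by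
    rw [List.getElem?_drop, getElem?_factor W (by omega)]
    congr 1
    omega
  rw [← h1, ← h2, ← hr]
  refine List.getElem?_append_left ?_
  by_contra hc
  rw [List.getElem?_eq_none (not_lt.1 hc), List.getElem?_eq_getElem hxW] at h1
  simp at h1

/-- A set of more than `n * M` naturals has `n` elements that are pairwise `M` apart. -/
theorem exists_spaced {S : Finset ℕ} {n M : ℕ} (h : n * M < S.card) :
    ∃ s : ℕ → ℕ, (∀ k < n, s k ∈ S) ∧ ∀ k, k + 1 < n → s k + M ≤ s (k + 1) := by
  have hmem : ∀ k < S.card, Nat.nth (· ∈ S) k ∈ S := fun k hk =>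
    Nat.nth_mem (p := (· ∈ S)) k fun hf => by simpa using hk
  have hstep : ∀ k < n * M, Nat.nth (· ∈ S) k < Nat.nth (· ∈ S) (k + 1) := fun k hk =>
    Nat.nth_lt_nth' (p := (· ∈ S)) (Nat.lt_succ_self k) fun hf => by
      simpa using (by omega : k + 1 < S.card)
  have hidx : ∀ k ≤ n, k * M ≤ n * M := fun k hk => Nat.mul_le_mul_right _ hk
  refine ⟨fun k => Nat.nth (· ∈ S) (k * M), fun k hk => hmem _ ?_, fun k hk => ?_⟩
  · have := hidx k hk.le
    omega
  · simp only [Nat.succ_mul]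
    refine add_le_of_step hstep ?_
    have := hidx (k + 1) hk.le
    rwa [Nat.succ_mul] at this

/-- In a word that is not `n`-divisible, an aperiodic factor occurs boundedly often. -/
theorem card_occurrences_le {α : Type*} [LinearOrder α] {W : List α} {n M : ℕ} (hn : 1 ≤ n)
    (hM : 3 * n ≤ M) (hW : ¬ IsDivisible n W) {S : Finset ℕ} {u : List α}
    (hS : ∀ i ∈ S, factor W i M = u ∧ ¬ IsLocallyPeriodic n W (i + n)) : S.card ≤ n * M := by
  by_contra! hc
  obtain ⟨s, hsS, hs⟩ := exists_spaced hc
  have hpre : ∀ a b, a < b → b < n → ¬ u.drop b <+: u.drop a := by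
    intro a b hab hb
    obtain ⟨h1, h2⟩ := hS _ (hsS 0 (by omega))
    rw [← h1]
    exact not_drop_prefix_drop hM h2 hab hb
  have hinj : Set.InjOn (fun a => u.drop a) (Finset.range n) := by
    intro a ha b hb hab
    simp only [Finset.coe_range, Set.mem_Iio] at ha hb hab
    rcases lt_trichotomy a b with h | h | h
    · exact absurd (by rw [hab]) (hpre a b h hb)
    · exact h
    · exact absurd (by rw [hab]) (hpre b a h ha)
  have hcard : ((Finset.range n).image fun a => u.drop a).card = n := by
    rw [Finset.card_image_of_injOn hinj, Finset.card_range]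
  let e := ((Finset.range n).image fun a => u.drop a).orderEmbOfFin hcard
  have he : ∀ k : Fin n, ∃ a < n, u.drop a = e k := fun k => by
    have := Finset.orderEmbOfFin_mem _ hcard k
    simpa only [Finset.mem_image, Finset.mem_range] using this
  choose a ha hae using he
  -- `e` lists the suffixes in increasing order, so `r` reverses it; the `%` only makes `r` total.
  let r : ℕ → Fin n := fun k => Fin.rev ⟨k % n, Nat.mod_lt _ hn⟩
  have hr : ∀ k, k + 1 < n → r (k + 1) < r k := fun k hk => by
    simp only [r, Fin.rev_lt_rev, Fin.mk_lt_mk]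
    rw [Nat.mod_eq_of_lt hk, Nat.mod_eq_of_lt (by omega)]
    omega
  have hu : ∀ k < n, u = factor W (s k) M := fun k hk => (hS _ (hsS k hk)).1.symm
  refine hW (isDivisible_of_prefixes hn (fun k => s k + a (r k)) (fun k => u.drop (a (r k)))
    (fun k hk => ?_) (fun k hk => ?_) (fun k hk => ?_))
  · rw [hu k hk, ← List.drop_drop]
    exact (List.take_prefix _ _).drop _
  · have h1 := hs k hk
    have h2 : u.length ≤ M := by
      rw [hu k (by omega)]
      exact List.length_take_le _ _
    have h3 := ha (r k)
    have h4 := ha (r (k + 1))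
    simp only [List.length_drop]
    omega
  · have hlt : u.drop (a (r (k + 1))) < u.drop (a (r k)) := by
      rw [hae, hae]
      exact e.strictMono (hr k hk)
    refine (gt_or_prefix_of_lt hlt).resolve_right fun hp => ?_
    rcases lt_or_ge (a (r k)) (a (r (k + 1))) with h | h
    · exact hpre _ _ h (ha _) hp
    · refine hlt.ne (hp.eq_of_length_le ?_)
      simp only [List.length_drop]
      omega

/-- The period `q` of the first window persists: to reach one new letter, step back by the local
period `q'`, apply `q` there, and step forward by `q'`. Length `2 * n` has room for both, as `q` and
`q'` are below `n`. -/
theorem exists_period_of_forall_isLocallyPeriodic {α : Type*} {W : List α} {n i e : ℕ}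
    (hn : 2 ≤ n) (h : ∀ j, i ≤ j → j < e → IsLocallyPeriodic n W j) :
    ∃ q, 0 < q ∧ q < n ∧ ∀ x, i ≤ x → x + q < e → x + q < W.length → W[x]? = W[x + q]? := by
  rcases le_or_gt e i with hei | hie
  · exact ⟨1, one_pos, hn, fun x h1 h2 => by omega⟩
  obtain ⟨q, hq0, hqn, hq⟩ := h i le_rfl hie
  have key : ∀ t, i + t < e → ∀ x, i ≤ x → x + q < i + t + 2 * n → x + q < W.length →
      W[x]? = W[x + q]? := by
    intro t
    induction t with
    | zero => intro _; exact hq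
    | succ t ih =>
      intro ht x hx hxq hxW
      have ih := ih (by omega)
      rcases lt_or_ge (x + q) (i + t + 2 * n) with hlt | hge
      · exact ih x hx hlt hxW
      obtain ⟨q', hq0', hqn', hq'⟩ := h (i + (t + 1)) (by omega) ht
      have e1 := hq' (x - q') (by omega) (by omega) (by omega)
      have e2 := hq' (x + q - q') (by omega) (by omega) (by omega)
      have e3 := ih (x - q') (by omega) (by omega) (by omega)
      rw [show x - q' + q' = x by omega] at e1
      rw [show x + q - q' + q' = x + q by omega] at e2
      rw [show x - q' + q = x + q - q' by omega] at e3
      rw [← e1, e3, e2]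
  exact ⟨q, hq0, hqn, fun x h1 h2 h3 => key (e - 1 - i) (by omega) x h1 (by omega) h3⟩

theorem exists_power_append_of_period {α : Type*} {q : ℕ} (hq : 0 < q) (L : List α)
    (h : ∀ x, x + q < L.length → L[x]? = L[x + q]?) :
    ∃ k r, r.length < q ∧ L = power (L.take q) k ++ r := by
  induction hL : L.length using Nat.strong_induction_on generalizing L with
  | _ m ih =>
    subst hL
    rcases lt_or_ge L.length q with hlt | hge
    · exact ⟨0, L, hlt, by simp [power]⟩
    rcases lt_or_ge (L.drop q).length q with hlt | hge2
    · exact ⟨1, L.drop q, hlt, by simp [power]⟩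
    obtain ⟨k, r, hr, hk⟩ := ih (L.drop q).length (by simp; omega) (L.drop q)
      (fun x hx => by
        simp only [List.length_drop] at hx
        rw [List.getElem?_drop, List.getElem?_drop, ← add_assoc]
        rw [h (q + x) (by omega)]) rfl
    have htake : (L.drop q).take q = L.take q := by
      simp only [List.length_drop] at hge2
      refine List.ext_getElem? fun x => ?_
      rw [List.getElem?_take, List.getElem?_take]
      split_ifs with hx
      · rw [List.getElem?_drop, h x (by omega), add_comm]
      · rfl
    refine ⟨k + 1, r, hr, ?_⟩
    rw [htake] at hk
    conv_lhs => rw [← List.take_append_drop q L, hk]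
    simp [power, List.replicate_succ]

end Periodicity

/-! ### From aperiodic positions to height. -/

section Height

variable {α : Type*}

theorem IsProductOfPowers.append {Y : Set (List α)} {h₁ h₂ : ℕ} {u v : List α}
    (hu : IsProductOfPowers Y h₁ u) (hv : IsProductOfPowers Y h₂ v) :
    IsProductOfPowers Y (h₁ + h₂) (u ++ v) := by
  obtain ⟨f, hf, hfY, rfl⟩ := hu
  obtain ⟨g, hg, hgY, rfl⟩ := hv
  refine ⟨f ++ g, by simp; omega, fun x hx => ?_, by simp⟩
  rcases List.mem_append.1 hx with hx | hx
  exacts [hfY x hx, hgY x hx]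

theorem IsProductOfPowers.mono {Y : Set (List α)} {h₁ h₂ : ℕ} {u : List α}
    (hu : IsProductOfPowers Y h₁ u) (hh : h₁ ≤ h₂) : IsProductOfPowers Y h₂ u := by
  obtain ⟨f, hf, hfY, rfl⟩ := hu
  exact ⟨f, hf.trans hh, hfY, rfl⟩

theorem isProductOfPowers_power {Y : Set (List α)} {u : List α} (hu : u ∈ Y) (k : ℕ) :
    IsProductOfPowers Y 1 (power u k) :=
  ⟨[(u, k)], by simp, by simpa using hu, by simp⟩

theorem isProductOfPowers_of_mem {Y : Set (List α)} {u : List α} (hu : u ∈ Y) :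
    IsProductOfPowers Y 1 u := by
  simpa [power] using isProductOfPowers_power hu 1

theorem isProductOfPowers_nil (Y : Set (List α)) (h : ℕ) : IsProductOfPowers Y h [] :=
  ⟨[], by simp, by simp, by simp⟩

open Classical in
/-- The number of powers needed is governed by the number of positions where the word is not
locally periodic. -/
theorem isProductOfPowers_drop {n : ℕ} (hn : 2 ≤ n) (W : List α) (i : ℕ) :
    IsProductOfPowers {u : List α | u.length < n}
      (3 * ((Finset.Ico i W.length).filter fun j => ¬ IsLocallyPeriodic n W j).card + 2)
      (W.drop i) := by
  induction hm : W.length - i using Nat.strong_induction_on generalizing i with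
  | _ m ih =>
    subst hm
    rcases le_or_gt W.length i with hle | hlt
    · rw [List.drop_eq_nil_of_le hle]
      exact isProductOfPowers_nil _ _
    -- `e` is the next aperiodic position, or the end. It costs a power, a remainder and the letter
    -- `W[e]`, hence the factor `3`; the last stretch costs the final `2`.
    have hex : ∃ e, i ≤ e ∧ (W.length ≤ e ∨ ¬ IsLocallyPeriodic n W e) :=
      ⟨W.length, hlt.le, Or.inl le_rfl⟩
    obtain ⟨hie, he⟩ := Nat.find_spec hex
    have hmin : ∀ j, i ≤ j → j < Nat.find hex → j < W.length ∧ IsLocallyPeriodic n W j := by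
      intro j hij hj
      have := Nat.find_min hex hj
      push Not at this
      exact this hij
    set e := Nat.find hex
    obtain ⟨q, hq0, hqn, hq⟩ := exists_period_of_forall_isLocallyPeriodic hn
      fun j h1 h2 => (hmin j h1 h2).2
    obtain ⟨k, r, hr, hk⟩ := exists_power_append_of_period hq0 ((W.drop i).take (e - i))
      (fun x hx => by
        simp only [List.length_take, List.length_drop] at hx
        rw [List.getElem?_take_of_lt (by omega), List.getElem?_take_of_lt (by omega),
          List.getElem?_drop, List.getElem?_drop, ← add_assoc]
        exact hq (i + x) (by omega) (by omega) (by omega))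
    have hper : IsProductOfPowers {u : List α | u.length < n} 2 ((W.drop i).take (e - i)) := by
      rw [hk]
      refine (isProductOfPowers_power ?_ k).append (isProductOfPowers_of_mem ?_)
      · exact (List.length_take_le _ _).trans_lt hqn
      · exact hr.trans hqn
    have hsplit : W.drop i = (W.drop i).take (e - i) ++ W.drop e := by
      conv_lhs => rw [← List.take_append_drop (e - i) (W.drop i), List.drop_drop]
      rw [Nat.add_sub_cancel' hie]
    rw [hsplit]
    rcases le_or_gt W.length e with hle | hlt'
    · rw [List.drop_eq_nil_of_le hle, List.append_nil]
      exact hper.mono (by omega)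
    have hbad := he.resolve_left (not_le.2 hlt')
    have hrest := ih (W.length - (e + 1)) (by omega) (e + 1) rfl
    have hletter : IsProductOfPowers {u : List α | u.length < n} 1 [W[e]] :=
      isProductOfPowers_of_mem (show 1 < n from hn)
    rw [List.drop_eq_getElem_cons hlt', ← List.singleton_append]
    refine (hper.append (hletter.append hrest)).mono ?_
    have hcard : ((Finset.Ico (e + 1) W.length).filter fun j => ¬ IsLocallyPeriodic n W j).card <
        ((Finset.Ico i W.length).filter fun j => ¬ IsLocallyPeriodic n W j).card := by
      refine Finset.card_lt_card (Finset.ssubset_iff_of_subset ?_ |>.2 ⟨e, ?_, ?_⟩)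
      · exact Finset.filter_subset_filter _ (Finset.Ico_subset_Ico_left (by omega))
      · simp [hie, hlt', hbad]
      · simp
    omega

open Classical in
theorem card_not_isLocallyPeriodic_le [LinearOrder α] [Fintype α] {W : List α} {n s : ℕ}
    (hn : 1 ≤ n) (hs : 3 * n ≤ 2 ^ s) (hW : ¬ IsDivisible n W) :
    ((Finset.Ico 0 W.length).filter fun j => ¬ IsLocallyPeriodic n W j).card ≤
      n + n * 2 ^ s *
        ((2 * (n * 2 ^ s) ^ 2) ^ s * (n * 2 ^ s * (Fintype.card α + 1))) := by
  set S := (Finset.range W.length).filter fun i => ¬ IsLocallyPeriodic n W (i + n) with hS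
  -- Occurrences are counted by windows starting `n` before the aperiodic position, so positions
  -- below `n` are bounded separately.
  have hsub : ((Finset.Ico 0 W.length).filter fun j => ¬ IsLocallyPeriodic n W j) ⊆
      Finset.range n ∪ S.image (· + n) := by
    intro j hj
    simp only [Finset.mem_filter, Finset.mem_Ico] at hj
    rcases lt_or_ge j n with h | h
    · exact Finset.mem_union_left _ (Finset.mem_range.2 h)
    · refine Finset.mem_union_right _ (Finset.mem_image.2 ⟨j - n, ?_, by omega⟩)
      simp only [hS, Finset.mem_filter, Finset.mem_range, Nat.sub_add_cancel h]
      exact ⟨by omega, hj.2⟩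
  refine (Finset.card_le_card hsub).trans ((Finset.card_union_le _ _).trans ?_)
  rw [Finset.card_range]
  refine Nat.add_le_add_left (Finset.card_image_le.trans ?_) _
  refine (Finset.card_le_mul_card_image (f := fun i => factor W i (2 ^ s)) S (n * 2 ^ s)
    fun u _ => card_occurrences_le hn hs hW (u := u) fun i hi => ?_).trans ?_
  · simp only [hS, Finset.mem_filter] at hi
    exact ⟨hi.2, hi.1.2⟩
  · refine Nat.mul_le_mul_left _ (le_trans (Finset.card_le_card ?_)
      (card_factors_le hn hW W.length))
    exact Finset.image_subset_image (Finset.filter_subset _ _)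

theorem height_le {Y S : Set (List α)} {h : ℕ} (hS : ∀ W ∈ S, IsProductOfPowers Y h W) :
    height Y S ≤ h :=
  iInf₂_le h hS

end Height

/-! ### Numerical estimate and conclusion. -/

/-- The explicit count obtained for windows of length `2 ^ s` lies below the stated bound. -/
theorem numeric_bound {n l s : ℕ} (hn : 2 ≤ n) (hl : 1 ≤ l) (hs : 2 ^ s ≤ 8 * n) :
    ((3 * (n + n * 2 ^ s * ((2 * (n * 2 ^ s) ^ 2) ^ s * (n * 2 ^ s * (l + 1)))) + 2 : ℕ) : ℝ) ≤
      2 ^ 40 * (l : ℝ) * (n : ℝ) ^ (38 + 8 * Real.logb 2 (n : ℝ)) := by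
  set L := Real.logb 2 (n : ℝ) with hLdef
  have hn0 : (0 : ℝ) < n := by positivity
  have hnR : (2 : ℝ) ≤ n := by exact_mod_cast hn
  have hlR : (1 : ℝ) ≤ l := by exact_mod_cast hl
  have hnL : (2 : ℝ) ^ L = n := Real.rpow_logb two_pos (by norm_num) hn0
  have hL1 : 1 ≤ L := by
    rw [hLdef, Real.le_logb_iff_rpow_le (by norm_num) hn0]
    simpa using hnR
  have hsR : (2 : ℝ) ^ s ≤ 8 * n := by exact_mod_cast hs
  have hsL : (s : ℝ) ≤ L + 3 := by
    have h8 : (2 : ℝ) ^ (L + 3) = 8 * n := by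
      rw [Real.rpow_add two_pos, hnL]
      norm_num
      ring
    rw [← Real.rpow_natCast, ← h8] at hsR
    exact (Real.rpow_le_rpow_left_iff (by norm_num)).1 hsR
  have hp : (n : ℝ) * 2 ^ s ≤ 2 ^ (2 * L + 3) := by
    have : (2 : ℝ) ^ (2 * L + 3) = n * (8 * n) := by
      rw [Real.rpow_add two_pos, two_mul, Real.rpow_add two_pos, hnL]
      norm_num
      ring
    rw [this]
    gcongr
  have hbase : 2 * ((n : ℝ) * 2 ^ s) ^ 2 ≤ 2 ^ (4 * L + 7) := by
    have : (2 : ℝ) ^ (4 * L + 7) = 2 * (2 ^ (2 * L + 3)) ^ 2 := by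
      rw [← Real.rpow_natCast, ← Real.rpow_mul two_pos.le, ← Real.rpow_one_add' two_pos.le]
      · congr 1
        push_cast
        ring
      · push_cast
        positivity
    rw [this]
    gcongr
  have hpow : (2 * ((n : ℝ) * 2 ^ s) ^ 2) ^ s ≤ 2 ^ ((4 * L + 7) * (L + 3)) := by
    calc (2 * ((n : ℝ) * 2 ^ s) ^ 2) ^ s ≤ ((2 : ℝ) ^ (4 * L + 7)) ^ s := by gcongr
      _ = 2 ^ ((4 * L + 7) * (s : ℝ)) := by
        rw [← Real.rpow_natCast, ← Real.rpow_mul two_pos.le]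
      _ ≤ _ := by
        apply Real.rpow_le_rpow_of_exponent_le (by norm_num)
        gcongr
  -- The exponent is `2 * (2 * L + 3) + (4 * L + 7) * (L + 3) + 1`, the last `1` coming from `l + 1
  -- ≤ 2 * l`.
  have hmain : (n : ℝ) * 2 ^ s * ((2 * (n * 2 ^ s) ^ 2) ^ s * (n * 2 ^ s * (l + 1))) ≤
      2 ^ (4 * L ^ 2 + 23 * L + 28) * l := by
    calc (n : ℝ) * 2 ^ s * ((2 * (n * 2 ^ s) ^ 2) ^ s * (n * 2 ^ s * (l + 1)))
        ≤ 2 ^ (2 * L + 3) * (2 ^ ((4 * L + 7) * (L + 3)) * (2 ^ (2 * L + 3) * (2 * l))) := by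
          gcongr
          linarith
      _ = 2 ^ (2 * L + 3) * (2 ^ ((4 * L + 7) * (L + 3)) * (2 ^ (2 * L + 3) * 2 ^ (1 : ℝ))) * l := by
          rw [Real.rpow_one]
          ring
      _ = _ := by
          rw [← Real.rpow_add two_pos, ← Real.rpow_add two_pos, ← Real.rpow_add two_pos]
          congr 2
          ring
  have hsmall : (n : ℝ) ≤ 2 ^ (4 * L ^ 2 + 23 * L + 28) * l := by
    calc (n : ℝ) = 2 ^ L * 1 := by rw [hnL, mul_one]
      _ ≤ _ := by
        gcongr
        · norm_num
        · nlinarith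
  have hrhs : 2 ^ 40 * (l : ℝ) * (n : ℝ) ^ (38 + 8 * L) = 2 ^ (40 + L * (38 + 8 * L)) * l := by
    rw [Real.rpow_add two_pos, Real.rpow_mul two_pos.le, hnL]
    norm_num
    ring
  rw [hrhs]
  push_cast
  calc (3 : ℝ) * ((n : ℝ) + n * 2 ^ s * ((2 * (n * 2 ^ s) ^ 2) ^ s * (n * 2 ^ s * (l + 1)))) + 2
      ≤ 8 * (2 ^ (4 * L ^ 2 + 23 * L + 28) * l) := by linarith
    _ = (2 : ℝ) ^ ((3 : ℝ) + (4 * L ^ 2 + 23 * L + 28)) * (l : ℝ) := by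
      rw [Real.rpow_add two_pos (3 : ℝ), show (2 : ℝ) ^ (3 : ℝ) = 8 by norm_num, mul_assoc]
    _ ≤ _ := by
      refine mul_le_mul_of_nonneg_right ?_ (by positivity)
      exact Real.rpow_le_rpow_of_exponent_le (by norm_num) (by nlinarith)

end Word

theorem theoremt1 {α : Type*} [LinearOrder α] [Fintype α] (n l : ℕ) (hn : 1 ≤ n)
    (hl : Fintype.card α = l) :
    ∃ h : ℕ,
      Word.height {u : List α | u.length < n} {W : List α | ¬ Word.IsDivisible n W} = (h : ℕ∞) ∧
        (h : ℝ) ≤ 2 ^ 40 * (l : ℝ) * (n : ℝ) ^ (38 + 8 * Real.logb 2 (n : ℝ)) := by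
  suffices H : ∃ H : ℕ, (∀ W ∈ {W : List α | ¬ Word.IsDivisible n W},
      Word.IsProductOfPowers {u : List α | u.length < n} H W) ∧
      (H : ℝ) ≤ 2 ^ 40 * (l : ℝ) * (n : ℝ) ^ (38 + 8 * Real.logb 2 (n : ℝ)) by
    obtain ⟨H, hH, hle⟩ := H
    have hht := Word.height_le hH
    obtain ⟨h, hh⟩ := ENat.ne_top_iff_exists.1 (hht.trans_lt (ENat.natCast_lt_top H)).ne
    refine ⟨h, hh.symm, le_trans ?_ hle⟩
    rw [← hh] at hht
    exact_mod_cast hht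
  rcases hn.eq_or_lt with rfl | hn2
  -- Every word is `1`-divisible, with an empty single block.
  · refine ⟨0, fun W hW => absurd ⟨W, [[]], by simp, by simp, by simp⟩ hW, ?_⟩
    push_cast
    positivity
  rcases Nat.eq_zero_or_pos l with rfl | hlpos
  · have : IsEmpty α := Fintype.card_eq_zero_iff.1 hl
    refine ⟨0, fun W _ => ?_, by simp⟩
    rw [Subsingleton.elim W []]
    exact Word.isProductOfPowers_nil _ _
  have hlow : n ≤ 2 ^ Nat.clog 2 n := Nat.le_pow_clog one_lt_two n
  have hup : 2 ^ Nat.clog 2 n ≤ 2 * n := by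
    have h1 := Nat.pow_pred_clog_lt_self one_lt_two hn2
    have h2 : 0 < Nat.clog 2 n := Nat.clog_pos one_lt_two hn2
    obtain ⟨m, hm⟩ : ∃ m, Nat.clog 2 n = m + 1 := ⟨Nat.clog 2 n - 1, by omega⟩
    rw [hm, Nat.pred_succ] at h1
    rw [hm, pow_succ]
    omega
  -- The `+ 2` gives `4 * n ≤ 2 ^ s ≤ 8 * n`, which covers the required `3 * n`.
  refine ⟨_, fun W hW => ?_, Word.numeric_bound (s := Nat.clog 2 n + 2) hn2 hlpos ?_⟩
  · have h := Word.isProductOfPowers_drop hn2 W 0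
    rw [List.drop_zero] at h
    refine h.mono ?_
    have := Word.card_not_isLocallyPeriodic_le (s := Nat.clog 2 n + 2) hn
      (by rw [pow_add]; omega) hW
    rw [hl] at this
    omega
  · rw [pow_add]
    omega
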